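/- Let $k$ be a field of characteristic zero, let $d, m \ge 0$ be integers, and let $B := k[x_1,\dots,x_m]/(x_1^2,\dots,x_m^2)$. For a $d$-by-$m$ matrix $M=(m_{ij})$ of rank $d$ over $k$, let $A(M)$ be the $k$-subalgebra of $B$ generated by the linear forms $f_i=\sum_{j=1}^m m_{ij}x_j$ ($1\le i\le d$), and let $\mathcal{M}(M)$ be the matroid on $\{1,\dots,m\}$ whose independent sets are the sets of indices of linearly independent families of columns of $M$. Theorem. Let $M$ and $N$ be two $d$-by-$m$ matrices of rank $d$ over $k$. Then $A(M)$ and $A(N)$ are isomorphic as $k$-algebras if and only if $M$ and $N$ are linearly equivalent representations of the same matroid; that is, if and only if (i) $\mathcal{M}(M)$ and $\mathcal{M}(N)$ are the same matroid up to a relabelling of the ground set $\{1,\dots,m\}$ by a permutation, and (ii) there are an invertible $d$-by-$d$ matrix $Q$ and an $m$-by-$m$ monomial matrix $P$ over $k$ (one with exactly one nonzero entry in each row and in each column) such that $QMP=N$. (Condition (i) is a consequence of (ii).) -/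

import Mathlib

namespace RepMatroid

/-- The algebra `B = k[x_1, …, x_m] / (x_1², …, x_m²)`. -/
abbrev B (k : Type*) [Field k] (m : ℕ) : Type _ :=
  MvPolynomial (Fin m) k ⧸
    Ideal.span (Set.range fun j : Fin m => (MvPolynomial.X j : MvPolynomial (Fin m) k) ^ 2)

/-- The class of the indeterminate `x_j` in `B`. -/
noncomputable def x (k : Type*) [Field k] {m : ℕ} (j : Fin m) : B k m :=
  Ideal.Quotient.mk _ (MvPolynomial.X j)

/-- The linear form `c_1 x_1 + ⋯ + c_m x_m` in `B` given by a row vector `c`. -/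
noncomputable def linearForm {k : Type*} [Field k] {m : ℕ} (c : Fin m → k) : B k m :=
  ∑ j, c j • x k j

/-- `A(M)`: the `k`-subalgebra of `B` generated by the rows of `M`, read as linear forms. -/
noncomputable def A {k : Type*} [Field k] {d m : ℕ} (M : Matrix (Fin d) (Fin m) k) :
    Subalgebra k (B k m) :=
  Algebra.adjoin k (Set.range fun i : Fin d => linearForm (M i))

/-- A monomial matrix has exactly one nonzero entry in each row and in each column. -/
def IsMonomial {k : Type*} [Field k] {m : ℕ} (P : Matrix (Fin m) (Fin m) k) : Prop :=
  (∀ i, ∃! j, P i j ≠ 0) ∧ (∀ j, ∃! i, P i j ≠ 0)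

/-- Linear equivalence of two matrices of the same size: `Q M P = N` with `Q` invertible and
`P` monomial. -/
def LinearlyEquivalent {k : Type*} [Field k] {d m : ℕ} (M N : Matrix (Fin d) (Fin m) k) : Prop :=
  ∃ (Q : Matrix (Fin d) (Fin d) k) (P : Matrix (Fin m) (Fin m) k),
    IsUnit Q ∧ IsMonomial P ∧ Q * M * P = N

theorem indep_augment {k : Type*} [Field k] {d m : ℕ} (M : Matrix (Fin d) (Fin m) k)
    {I J : Set (Fin m)} (hI : LinearIndepOn k M.col I) (hJ : LinearIndepOn k M.col J)
    (hIJ : I.ncard < J.ncard) : ∃ e ∈ J, e ∉ I ∧ LinearIndepOn k M.col (insert e I) := by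
  classical
  by_contra! h
  have hle : Submodule.span k (M.col '' J) ≤ Submodule.span k (M.col '' I) := by
    rw [Submodule.span_le]
    rintro _ ⟨e, he, rfl⟩
    by_cases heI : e ∈ I
    · exact Submodule.subset_span ⟨e, heI, rfl⟩
    · by_contra hne
      exact h e he heI (hI.insert hne)
  have key : ∀ S : Set (Fin m), LinearIndepOn k M.col S →
      Module.finrank k (Submodule.span k (M.col '' S)) = S.ncard := by
    intro S hS
    have h1 := finrank_span_eq_card hS
    rw [Set.image_eq_range, ← Nat.card_coe_set_eq, Nat.card_eq_fintype_card]
    exact h1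
  have := Submodule.finrank_mono hle
  rw [key I hI, key J hJ] at this
  omega

/-- The matroid represented by `M`: its ground set is the set of column indices, and a set of
indices is independent when the corresponding family of columns is linearly independent. -/
noncomputable def columnMatroid {k : Type*} [Field k] {d m : ℕ} (M : Matrix (Fin d) (Fin m) k) :
    Matroid (Fin m) :=
  (IndepMatroid.ofFinite (E := Set.univ) Set.finite_univ
    (fun I => LinearIndepOn k M.col I)
    (linearIndepOn_empty k M.col)
    (fun _ _ hJ hIJ => hJ.mono hIJ)
    (fun _ _ hI hJ hIJ => indep_augment M hI hJ hIJ)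
    (fun I _ => Set.subset_univ I)).matroid

/-- `M` and `N` represent the same matroid, up to relabelling the ground set. -/
def RepresentSameMatroid {k : Type*} [Field k] {d m : ℕ}
    (M N : Matrix (Fin d) (Fin m) k) : Prop :=
  ∃ σ : Equiv.Perm (Fin m), columnMatroid N = (columnMatroid M).mapEquiv σ

end RepMatroid

/-!
A linear equivalence `Q M P = N` gives an isomorphism `A(M) ≃ A(N)`: multiplication by `Q` does
not change the span of the rows, and a monomial `P` is induced by the automorphism of `B` that
permutes and rescales the indeterminates. It also matches the columns of `N` with those of `M` up
to scalars and an invertible map, so the column matroids agree after relabelling.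

For the converse, the point is that `A(M)` remembers the Hamming weights of the vectors in the row
space of `M`. In characteristic zero a linear form with `w` nonzero coefficients has nonzero `w`-th
power, namely `w!` times a nonzero multiple of a squarefree monomial, and vanishing `(w + 1)`-st
power (`linearForm_pow_eq_zero_iff`). An isomorphism need not be graded, but it preserves the
nilradical and its square, and modulo that square `A(N)` is spanned by `1` and its linear forms; so
it has a linear part `T` (`exists_linear_part`), which is invertible. Comparing lowest-degree
components (`linearForm_pow_eq_zero_of_add`) shows that `T` does not increase weights, and
neither does its inverse. So `v M` and `v T N` have equal weight for every `v`.

It remains to see that such `M` and `T N` differ by a monomial matrix, which is the MacWilliams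
extension theorem (`exists_isMonomial_of_hammingNorm_eq`). The columns are linear functionals on
`k ^ d`, and the hypothesis says that at every `v` equally many columns of either matrix vanish.
Over an infinite field, evaluating at a generic point of a subspace counts the kernels containing
it, so both families of columns have the same kernels with the same multiplicities
(`exists_perm_ker_eq`), and functionals with equal kernels are proportional.
-/

namespace RepMatroid

open Finset

/-! ### Powers of sums of square-zero elements, and squares of nilradicals -/

theorem sum_pow_card_of_sq_eq_zero {R ι : Type*} [CommRing R] (s : Finset ι) (y : ι → R)
    (hy : ∀ i, y i ^ 2 = 0) :
    (∑ i ∈ s, y i) ^ #s = ((#s).factorial : R) * ∏ i ∈ s, y i ∧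
      (∑ i ∈ s, y i) ^ (#s + 1) = 0 := by
  classical
  have key (a b : R) (ha : a ^ 2 = 0) (n : ℕ) :
      (a + b) ^ (n + 1) = b ^ (n + 1) + (n + 1) * a * b ^ n := by
    induction n with
    | zero => simp; ring
    | succ n ih =>
      rw [pow_succ (a + b), ih]
      push_cast
      linear_combination ((n : R) + 1) * b ^ n * ha
  induction s using Finset.induction_on with
  | empty => simp
  | insert i s hi ih =>
    rw [sum_insert hi, prod_insert hi, card_insert_of_notMem hi, key _ _ (hy i),
      key _ _ (hy i), pow_succ _ (#s + 1), ih.2, ih.1, Nat.factorial_succ]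
    push_cast
    constructor <;> ring

theorem map_mem_sq_of_mem_nilradical_sq {R S F : Type*} [CommRing R] [CommRing S] [FunLike F R S]
    [RingHomClass F R S] (f : F) {I : Ideal S} (h : ∀ r, IsNilpotent r → f r ∈ I) {r : R}
    (hr : r ∈ nilradical R ^ 2) :
    f r ∈ I ^ 2 := by
  have hI : Ideal.map f (nilradical R) ≤ I :=
    Ideal.map_le_iff_le_comap.2 fun r hr => Ideal.mem_comap.2 (h r (mem_nilradical.1 hr))
  exact Ideal.pow_right_mono hI 2 (Ideal.map_pow f _ 2 ▸ Ideal.mem_map_of_mem f hr)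

theorem map_mem_nilradical_sq {R S F : Type*} [CommRing R] [CommRing S] [FunLike F R S]
    [RingHomClass F R S] (f : F) {r : R}
    (hr : r ∈ nilradical R ^ 2) : f r ∈ nilradical S ^ 2 :=
  map_mem_sq_of_mem_nilradical_sq f (fun _ h => mem_nilradical.2 (h.map f)) hr

theorem X_mul_C_sq_eq_zero {R : Type*} [CommRing R] {b : R} (hb : b ^ 2 = 0) :
    (Polynomial.X * Polynomial.C b) ^ 2 = 0 := by
  rw [mul_pow, ← Polynomial.C_pow, hb, Polynomial.C_0, mul_zero]

theorem pow_eq_zero_of_X_mul_C_add_pow_eq_zero {R : Type*} [CommRing R] {b : R}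
    {p : Polynomial R} {n : ℕ}
    (h : (Polynomial.X * Polynomial.C b + Polynomial.X ^ 2 * p) ^ n = 0) : b ^ n = 0 := by
  rw [show Polynomial.X * Polynomial.C b + Polynomial.X ^ 2 * p =
      Polynomial.X * (Polynomial.C b + Polynomial.X * p) by ring, mul_pow,
    (Polynomial.isRegular_X_pow n).left.mul_left_eq_zero_iff] at h
  simpa using congrArg (Polynomial.eval 0) h

/-! ### The algebra `B` and its linear forms -/

section Algebra

variable {k : Type*} [Field k] {m : ℕ}

theorem x_sq (j : Fin m) : x k j ^ 2 = 0 := by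
  rw [x, ← map_pow]
  exact Ideal.Quotient.eq_zero_iff_mem.2 (Ideal.subset_span ⟨j, rfl⟩)

/-- The universal property of `B`: an algebra homomorphism out of `B` is given by elements of
square zero. -/
noncomputable def lift {R : Type*} [CommRing R] [Algebra k R] (y : Fin m → R)
    (hy : ∀ j, y j ^ 2 = 0) : B k m →ₐ[k] R :=
  Ideal.Quotient.liftₐ _ (MvPolynomial.aeval y) fun a ha => by
    have : Ideal.span (Set.range fun j : Fin m => (MvPolynomial.X j : MvPolynomial (Fin m) k) ^ 2)
        ≤ RingHom.ker (MvPolynomial.aeval (R := k) y) := by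
      rw [Ideal.span_le]
      rintro _ ⟨j, rfl⟩
      simp [RingHom.mem_ker, hy]
    exact this ha

@[simp]
theorem lift_x {R : Type*} [CommRing R] [Algebra k R] (y : Fin m → R)
    (hy : ∀ j, y j ^ 2 = 0) (j : Fin m) : lift y hy (x k j) = y j :=
  MvPolynomial.aeval_X y j

theorem algHom_ext {R : Type*} [CommRing R] [Algebra k R] {f g : B k m →ₐ[k] R}
    (h : ∀ j, f (x k j) = g (x k j)) : f = g :=
  Ideal.Quotient.algHom_ext _ (MvPolynomial.algHom_ext h)

theorem prod_x_ne_zero (s : Finset (Fin m)) : ∏ j ∈ s, x k j ≠ 0 := by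
  classical
  have hX : ∏ j ∈ s, (MvPolynomial.X j : MvPolynomial (Fin m) k) =
      MvPolynomial.monomial (∑ j ∈ s, Finsupp.single j 1) 1 := by
    simp [MvPolynomial.monomial_sum_one, MvPolynomial.X]
  have hI : (Set.range fun j : Fin m => (MvPolynomial.X j : MvPolynomial (Fin m) k) ^ 2) =
      (fun e => MvPolynomial.monomial e (1 : k)) '' Set.range fun j => Finsupp.single j 2 := by
    rw [← Set.range_comp]
    simp [Function.comp_def, MvPolynomial.X_pow_eq_monomial]
  simp only [x, ← map_prod]
  rw [Ne, Ideal.Quotient.eq_zero_iff_mem, hX, hI, MvPolynomial.mem_ideal_span_monomial_image]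
  intro h
  obtain ⟨_, ⟨j, rfl⟩, hj⟩ := h (∑ j ∈ s, Finsupp.single j 1)
    (by simp [MvPolynomial.mem_support_iff])
  have := hj j
  simp only [Finsupp.single_eq_same, Finsupp.finsetSum_apply, Finsupp.single_apply,
    sum_ite_eq'] at this
  split_ifs at this <;> omega

/-- In characteristic zero the nilpotency index of a linear form is one more than its Hamming
weight. -/
theorem linearForm_pow_eq_zero_iff [CharZero k] [DecidableEq k] (c : Fin m → k) (n : ℕ) :
    linearForm c ^ n = 0 ↔ hammingNorm c < n := by
  set s : Finset (Fin m) := {j | c j ≠ 0} with hs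
  have hc : linearForm c = ∑ j ∈ s, c j • x k j := by
    rw [linearForm, hs, sum_filter_of_ne]
    intro j _ hj h
    simp [h] at hj
  have hpow := sum_pow_card_of_sq_eq_zero s (fun j => c j • x k j) fun j => by
    rw [smul_pow, x_sq, smul_zero]
  rw [← hc] at hpow
  change _ ↔ #s < n
  constructor
  · intro h
    by_contra! hn
    have h0 : linearForm c ^ #s = 0 := pow_eq_zero_of_le hn h
    rw [hpow.1, prod_smul, ← nsmul_eq_mul, ← Nat.cast_smul_eq_nsmul k, smul_smul,
      smul_eq_zero] at h0
    refine h0.elim (mul_ne_zero (Nat.cast_ne_zero.2 (Nat.factorial_ne_zero _)) ?_)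
      (prod_x_ne_zero s)
    exact prod_ne_zero_iff.2 fun j hj => (mem_filter.1 hj).2
  · exact fun h => pow_eq_zero_of_le h hpow.2

/-- The homomorphism `b(x) ↦ b(t x)` from `B` to `B[t]`, which records the grading of `B`: the
coefficient of `t ^ n` in the image of `b` is the component of `b` of degree `n`. -/
noncomputable def scale (k : Type*) [Field k] (m : ℕ) : B k m →ₐ[k] Polynomial (B k m) :=
  lift (fun j => Polynomial.X * Polynomial.C (x k j)) fun j =>
    X_mul_C_sq_eq_zero (x_sq j)

theorem scale_linearForm (c : Fin m → k) :
    scale k m (linearForm c) = Polynomial.X * Polynomial.C (linearForm c) := by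
  simp only [linearForm, scale, map_sum, map_smul, lift_x, mul_sum, Polynomial.smul_C,
    ← mul_smul_comm]

theorem X_dvd_scale_of_isNilpotent {b : B k m} (hb : IsNilpotent b) :
    Polynomial.X ∣ scale k m b := by
  rw [Polynomial.X_dvd_iff, Polynomial.coeff_zero_eq_eval_zero]
  -- The constant term of `scale k m b` is the image of `b` under the augmentation `ε` to `k`.
  let ε : B k m →ₐ[k] k := lift (fun _ => 0) fun _ => by simp
  have h : ((Polynomial.aeval (0 : B k m)).restrictScalars k).comp (scale k m) =
      (Algebra.ofId k (B k m)).comp ε :=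
    algHom_ext fun j => by simp [scale, ε]
  have h' := DFunLike.congr_fun h b
  simp only [AlgHom.comp_apply, (hb.map ε).eq_zero, map_zero] at h'
  simpa [Polynomial.aeval_def, Polynomial.eval₂_eq_eval_map] using h'

/-- A linear form is the lowest-degree component of its perturbations by elements of the square
of the nilradical, so a power of it vanishes as soon as the same power of a perturbation does. -/
theorem linearForm_pow_eq_zero_of_add {c : Fin m → k} {q : B k m}
    (hq : q ∈ nilradical (B k m) ^ 2) {n : ℕ} (h : (linearForm c + q) ^ n = 0) :
    linearForm c ^ n = 0 := by
  have hq' := map_mem_sq_of_mem_nilradical_sq (scale k m)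
    (I := Ideal.span {Polynomial.X})
    (fun b hb => Ideal.mem_span_singleton.2 (X_dvd_scale_of_isNilpotent hb)) hq
  rw [Ideal.span_singleton_pow, Ideal.mem_span_singleton] at hq'
  obtain ⟨p, hp⟩ := hq'
  refine pow_eq_zero_of_X_mul_C_add_pow_eq_zero (p := p) ?_
  rw [← hp, ← scale_linearForm, ← map_add, ← map_pow, h, map_zero]

end Algebra

/-! ### Kernels of linear functionals over an infinite field -/

section Hyperplanes

variable {k V ι : Type*} [Field k] [AddCommGroup V] [Module k V]

/-- Over an infinite field a subspace has a point that lies only on those members of a given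
finite family of subspaces that contain it. -/
theorem exists_generic_mem [Infinite k] [Finite ι] (U : ι → Submodule k V) (W : Submodule k V) :
    ∃ v ∈ W, ∀ j, v ∈ U j → W ≤ U j := by
  by_contra! h
  -- The traces on `W` of the members not containing `W` would cover `W`.
  have hcov : ⋃ j : {j // ¬ W ≤ U j}, ((U j).comap W.subtype : Set W) = Set.univ := by
    refine Set.eq_univ_of_forall fun w => ?_
    obtain ⟨j, hj, hW⟩ := h w w.2
    exact Set.mem_iUnion.2 ⟨⟨j, hW⟩, hj⟩
  obtain ⟨⟨j, hj⟩, htop⟩ := Subspace.exists_eq_top_of_iUnion_eq_univ hcov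
  exact hj (Submodule.comap_subtype_eq_top.1 htop)

/-- The kernel of a linear functional is a maximal proper subspace or the whole space. -/
theorem ker_le_iff (f : Module.Dual k V) {W : Submodule k V} :
    LinearMap.ker f ≤ W ↔ W = LinearMap.ker f ∨ W = ⊤ := by
  refine ⟨fun h => ?_, ?_⟩
  · by_cases hf : f = 0
    · rw [hf, LinearMap.ker_zero, top_le_iff] at h
      exact Or.inr h
    · exact ((LinearMap.isCoatom_ker_of_surjective (LinearMap.surjective hf)).le_iff.1 h).symm
  · rintro (h | h) <;> simp [h]

/-- Linear functionals whose zero counts agree at every point have the same kernels, with the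
same multiplicities. -/
theorem exists_perm_ker_eq [Infinite k] [Fintype ι] [DecidableEq k] (f g : ι → Module.Dual k V)
    (h : ∀ v, #{j | f j v = 0} = #{j | g j v = 0}) :
    ∃ σ : Equiv.Perm ι, ∀ j, LinearMap.ker (f (σ j)) = LinearMap.ker (g j) := by
  classical
  -- Evaluating at a generic point of `W` counts the kernels that contain `W`.
  have hle (W : Submodule k V) :
      #{j | W ≤ LinearMap.ker (f j)} = #{j | W ≤ LinearMap.ker (g j)} := by
    obtain ⟨v, hv, hgen⟩ := exists_generic_mem
      (Sum.elim (fun j => LinearMap.ker (f j)) fun j => LinearMap.ker (g j)) W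
    have hf (j) : W ≤ LinearMap.ker (f j) ↔ f j v = 0 := ⟨fun hW => hW hv, hgen (Sum.inl j)⟩
    have hg (j) : W ≤ LinearMap.ker (g j) ↔ g j v = 0 := ⟨fun hW => hW hv, hgen (Sum.inr j)⟩
    simpa only [hf, hg] using h v
  -- Only `W` and `⊤` can contain a kernel `W`, so kernels equal to `W` are counted by difference.
  have heq (W : Submodule k V) (φ : Module.Dual k V) (hW : W = LinearMap.ker φ) :
      #{j | LinearMap.ker (f j) = W} = #{j | LinearMap.ker (g j) = W} := by
    by_cases htop : W = ⊤
    · simpa only [htop, top_le_iff] using hle ⊤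
    have hsplit (u : ι → Module.Dual k V) : #{j | W ≤ LinearMap.ker (u j)} =
        #{j | LinearMap.ker (u j) = W} + #{j | ⊤ ≤ LinearMap.ker (u j)} := by
      rw [← card_union_of_disjoint, ← filter_or]
      · congr 1
        ext j
        simp only [mem_filter, mem_univ, true_and, top_le_iff, hW, ker_le_iff]
      · refine disjoint_filter.2 fun j _ h₁ h₂ => htop ?_
        rw [← h₁, top_le_iff.1 h₂]
    have := hle W
    rw [hsplit f, hsplit g, hle ⊤] at this
    exact Nat.add_right_cancel this
  have hfib (W : Submodule k V) :
      #{j | LinearMap.ker (g j) = W} = #{j | LinearMap.ker (f j) = W} := by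
    by_cases hW : ∃ φ : Module.Dual k V, W = LinearMap.ker φ
    · obtain ⟨φ, hφ⟩ := hW
      exact (heq W φ hφ).symm
    · push Not at hW
      simp [fun φ => (hW φ).symm]
  let e (W : Submodule k V) : {j // LinearMap.ker (g j) = W} ≃ {j // LinearMap.ker (f j) = W} :=
    Fintype.equivOfCardEq (by simpa only [Fintype.card_subtype] using hfib W)
  exact ⟨Equiv.ofFiberEquiv e, Equiv.ofFiberEquiv_map e⟩

/-- Linear functionals with the same kernel are proportional. -/
theorem exists_ne_zero_smul_eq {f g : Module.Dual k V}
    (h : LinearMap.ker f = LinearMap.ker g) : ∃ a : k, a ≠ 0 ∧ g = a • f := by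
  have hg : g ∈ Submodule.span k (Set.range fun _ : Unit => f) :=
    mem_span_of_iInf_ker_le_ker (by simp [h])
  obtain ⟨a, ha⟩ := Submodule.mem_span_singleton.1 (by simpa using hg)
  by_cases h0 : a = 0
  · have hg0 : g = 0 := by rw [← ha, h0, zero_smul]
    refine ⟨1, one_ne_zero, ?_⟩
    rw [hg0, LinearMap.ker_zero, LinearMap.ker_eq_top] at h
    rw [hg0, h, smul_zero]
  · exact ⟨a, h0, ha.symm⟩

end Hyperplanes

/-! ### Monomial matrices and the MacWilliams extension theorem -/

section Monomial

variable {k : Type*} [Field k] {d m : ℕ}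

/-- The monomial matrix whose `j`-th column has its nonzero entry `a j` in row `σ j`. -/
def monomialMatrix (σ : Equiv.Perm (Fin m)) (a : Fin m → k) : Matrix (Fin m) (Fin m) k :=
  Matrix.of fun i j => if i = σ j then a j else 0

theorem isMonomial_monomialMatrix (σ : Equiv.Perm (Fin m)) {a : Fin m → k} (ha : ∀ j, a j ≠ 0) :
    IsMonomial (monomialMatrix σ a) := by
  refine ⟨fun i => ⟨σ.symm i, ?_, ?_⟩, fun j => ⟨σ j, ?_, ?_⟩⟩ <;>
    simp +contextual [monomialMatrix, ha, eq_comm]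

theorem IsMonomial.exists_eq {P : Matrix (Fin m) (Fin m) k} (hP : IsMonomial P) :
    ∃ (σ : Equiv.Perm (Fin m)) (a : Fin m → k), (∀ j, a j ≠ 0) ∧ P = monomialMatrix σ a := by
  choose s hs hsu using hP.2
  have hinj : Function.Injective s := fun j j' h =>
    (hP.1 (s j)).unique (hs j) (by simpa only [h] using hs j')
  refine ⟨Equiv.ofBijective s hinj.bijective_of_finite, fun j => P (s j) j, hs, ?_⟩
  ext i j
  simp only [monomialMatrix, Matrix.of_apply, Equiv.ofBijective_apply]
  split_ifs with h
  · rw [h]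
  · by_contra h0
    exact h (hsu j i h0)

theorem mul_monomialMatrix_apply (M : Matrix (Fin d) (Fin m) k) (σ : Equiv.Perm (Fin m))
    (a : Fin m → k) (i : Fin d) (j : Fin m) :
    (M * monomialMatrix σ a) i j = M i (σ j) * a j := by
  simp [Matrix.mul_apply, monomialMatrix]

theorem columnMatroid_indep_iff (M : Matrix (Fin d) (Fin m) k) (I : Set (Fin m)) :
    (columnMatroid M).Indep I ↔ LinearIndepOn k M.col I := Iff.rfl

/-- **MacWilliams extension theorem** over an infinite field: matrices that encode every vector
by words of equal Hamming weight differ by a monomial matrix. -/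
theorem exists_isMonomial_of_hammingNorm_eq [Infinite k] [DecidableEq k]
    (M N : Matrix (Fin d) (Fin m) k)
    (h : ∀ v, hammingNorm (Matrix.vecMul v M) = hammingNorm (Matrix.vecMul v N)) :
    ∃ P : Matrix (Fin m) (Fin m) k, IsMonomial P ∧ M * P = N := by
  let f (L : Matrix (Fin d) (Fin m) k) (j : Fin m) : Module.Dual k (Fin d → k) :=
    LinearMap.proj j ∘ₗ L.vecMulLinear
  obtain ⟨σ, hσ⟩ := exists_perm_ker_eq (f M) (f N) fun v => by
    have hc (L : Matrix (Fin d) (Fin m) k) :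
        #{j | f L j v = 0} + hammingNorm (Matrix.vecMul v L) = m := by
      have := card_filter_add_card_filter_not (s := (univ : Finset (Fin m)))
        fun j => f L j v = 0
      rw [card_univ, Fintype.card_fin] at this
      convert this
      rfl
    have h₁ := hc M
    have h₂ := hc N
    have := h v
    omega
  choose a ha hfa using fun j => exists_ne_zero_smul_eq (hσ j)
  refine ⟨monomialMatrix σ a, isMonomial_monomialMatrix σ ha, ?_⟩
  ext i j
  have := LinearMap.congr_fun (hfa j) (Pi.single i 1)
  simp only [f, LinearMap.comp_apply, LinearMap.smul_apply, Matrix.vecMulLinear_apply,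
    LinearMap.proj_apply, Matrix.single_one_vecMul, smul_eq_mul] at this
  rw [mul_monomialMatrix_apply, mul_comm]
  exact this.symm

theorem LinearlyEquivalent.representSameMatroid {M N : Matrix (Fin d) (Fin m) k}
    (h : LinearlyEquivalent M N) : RepresentSameMatroid M N := by
  obtain ⟨Q, P, hQ, hP, rfl⟩ := h
  obtain ⟨σ, a, ha, rfl⟩ := hP.exists_eq
  -- Column `j` of `N` comes from column `σ j` of `M`, so the relabelling of `M` is by `σ⁻¹`.
  refine ⟨σ.symm, Matroid.ext_indep (by simp [columnMatroid]) fun I _ => ?_⟩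
  rw [Matroid.mapEquiv_indep_iff, columnMatroid_indep_iff, columnMatroid_indep_iff,
    Equiv.symm_symm, ← linearIndepOn_equiv]
  have hcol : (Q * M * monomialMatrix σ a).col =
      fun j => Units.mk0 (a j) (ha j) • Matrix.mulVecLin Q (M.col (σ j)) := by
    ext j i
    simp only [Matrix.col_apply, mul_monomialMatrix_apply, Units.smul_mk0, Pi.smul_apply,
      Matrix.mulVecLin_apply, smul_eq_mul, mul_comm (a j)]
    rfl
  have hker : LinearMap.ker Q.mulVecLin = ⊥ :=
    LinearMap.ker_eq_bot.2 (Matrix.mulVec_injective_of_isUnit hQ)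
  rw [hcol, LinearIndepOn, LinearIndepOn]
  refine (LinearIndependent.units_smul_iff (fun j : I => Q.mulVecLin (M.col (σ j)))
    (fun j : I => Units.mk0 (a j) (ha j))).trans ?_
  exact Q.mulVecLin.linearIndependent_iff hker

end Monomial

/-! ### The linear part of an isomorphism -/

section LinearPart

variable {k : Type*} [Field k] {d m : ℕ}

instance : Nontrivial (B k m) :=
  ⟨⟨1, 0, by simpa using prod_x_ne_zero (k := k) (∅ : Finset (Fin m))⟩⟩

/-- The combination of the generators of `A(M)` with coefficients `v`, that is, the linear form
given by the vector `v M` of the row space. -/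
noncomputable def rowForm (M : Matrix (Fin d) (Fin m) k) : (Fin d → k) →ₗ[k] A M :=
  Fintype.linearCombination k fun i =>
    (⟨linearForm (M i), Algebra.subset_adjoin ⟨i, rfl⟩⟩ : A M)

theorem coe_rowForm (M : Matrix (Fin d) (Fin m) k) (v : Fin d → k) :
    (rowForm M v : B k m) = linearForm (Matrix.vecMul v M) := by
  simp only [rowForm, Fintype.linearCombination_apply, AddSubmonoidClass.coe_finsetSum,
    Subalgebra.coe_smul, linearForm, Matrix.vecMul, dotProduct, smul_sum, sum_smul, smul_smul]
  exact sum_comm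

theorem rowForm_single (M : Matrix (Fin d) (Fin m) k) (i : Fin d) :
    rowForm M (Pi.single i 1) = ⟨linearForm (M i), Algebra.subset_adjoin ⟨i, rfl⟩⟩ := by
  simp [rowForm, Fintype.linearCombination_apply_single]

theorem vecMul_injective_of_rank_eq {M : Matrix (Fin d) (Fin m) k} (hM : M.rank = d) :
    Function.Injective fun v => Matrix.vecMul v M := by
  rw [Matrix.vecMul_injective_iff, linearIndependent_iff_card_eq_finrank_span,
    Fintype.card_fin, Set.finrank, ← Matrix.rank_eq_finrank_span_row, hM]

variable [CharZero k]

theorem rowForm_mem_nilradical (M : Matrix (Fin d) (Fin m) k) (v : Fin d → k) :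
    rowForm M v ∈ nilradical (A M) := by
  classical
  refine mem_nilradical.2 ⟨hammingNorm (Matrix.vecMul v M) + 1, Subtype.ext ?_⟩
  rw [Subalgebra.coe_pow, coe_rowForm]
  exact (linearForm_pow_eq_zero_iff _ _).2 (Nat.lt_succ_self _)

/-- Modulo the square of its nilradical, `A(N)` is spanned by `1` and its linear forms. -/
theorem exists_sub_mem_nilradical_sq (N : Matrix (Fin d) (Fin m) k) (a : A N) :
    ∃ (c : k) (v : Fin d → k),
      a - algebraMap k (A N) c - rowForm N v ∈ nilradical (A N) ^ 2 := by
  obtain ⟨b, hb⟩ := a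
  induction hb using Algebra.adjoin_induction with
  | mem b hb =>
    obtain ⟨i, rfl⟩ := hb
    exact ⟨0, Pi.single i 1, by simp [rowForm_single]⟩
  | algebraMap c =>
    refine ⟨c, 0, ?_⟩
    rw [map_zero, sub_zero]
    convert Ideal.zero_mem _
    exact sub_self _
  | add b b' hb hb' h h' =>
    obtain ⟨c, v, h⟩ := h
    obtain ⟨c', v', h'⟩ := h'
    refine ⟨c + c', v + v', ?_⟩
    convert Ideal.add_mem _ h h' using 1
    rw [map_add, map_add, show (⟨b + b', add_mem hb hb'⟩ : A N) = ⟨b, hb⟩ + ⟨b', hb'⟩ from rfl]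
    ring
  | mul b b' hb hb' h h' =>
    obtain ⟨c, v, h⟩ := h
    obtain ⟨c', v', h'⟩ := h'
    refine ⟨c * c', c • v' + c' • v, ?_⟩
    have hvv : rowForm N v * rowForm N v' ∈ nilradical (A N) ^ 2 := by
      rw [sq]
      exact Ideal.mul_mem_mul (rowForm_mem_nilradical N v) (rowForm_mem_nilradical N v')
    convert Ideal.add_mem _ (Ideal.add_mem _ (Ideal.mul_mem_right ⟨b', hb'⟩ _ h)
      (Ideal.mul_mem_left _ (algebraMap k (A N) c + rowForm N v) h')) hvv using 1
    rw [map_add, map_smul, map_smul, map_mul, Algebra.smul_def, Algebra.smul_def,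
      show (⟨b * b', mul_mem hb hb'⟩ : A N) = ⟨b, hb⟩ * ⟨b', hb'⟩ from rfl]
    ring

theorem exists_sub_rowForm_mem_of_mem_nilradical (N : Matrix (Fin d) (Fin m) k) {a : A N}
    (ha : a ∈ nilradical (A N)) : ∃ v, a - rowForm N v ∈ nilradical (A N) ^ 2 := by
  obtain ⟨c, v, h⟩ := exists_sub_mem_nilradical_sq N a
  have hc : algebraMap k (A N) c ∈ nilradical (A N) := by
    convert sub_mem (sub_mem ha (Ideal.pow_le_self two_ne_zero h)) (rowForm_mem_nilradical N v)
      using 1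
    ring
  -- The constant term is nilpotent in `k`.
  have hc0 : c = 0 :=
    ((IsNilpotent.map_iff (algebraMap k (A N)).injective).1 (mem_nilradical.1 hc)).eq_zero
  exact ⟨v, by simpa [hc0] using h⟩

/-- The square of the nilradical contains no nonzero linear form. -/
theorem vecMul_eq_zero_of_rowForm_mem {M : Matrix (Fin d) (Fin m) k} {v : Fin d → k}
    (h : rowForm M v ∈ nilradical (A M) ^ 2) : Matrix.vecMul v M = 0 := by
  classical
  have hB := map_mem_nilradical_sq (A M).val h
  -- The linear form perturbed by its own negative is zero.
  have h1 := linearForm_pow_eq_zero_of_add (c := Matrix.vecMul v M) (n := 1) (neg_mem hB)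
    (by
      rw [pow_one, ← coe_rowForm]
      exact add_neg_cancel _)
  rw [linearForm_pow_eq_zero_iff, Nat.lt_one_iff] at h1
  exact hammingNorm_eq_zero.1 h1

/-- The linear part of an isomorphism `A(M) ≃ A(N)`, as a matrix in the coordinates of the row
spaces. -/
theorem exists_linear_part {M N : Matrix (Fin d) (Fin m) k} (φ : A M ≃ₐ[k] A N) :
    ∃ T : Matrix (Fin d) (Fin d) k, ∀ v,
      φ (rowForm M v) - rowForm N (Matrix.vecMul v T) ∈ nilradical (A N) ^ 2 := by
  have hφ (v) : φ (rowForm M v) ∈ nilradical (A N) :=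
    mem_nilradical.2 ((mem_nilradical.1 (rowForm_mem_nilradical M v)).map φ)
  choose t ht using fun i : Fin d =>
    exists_sub_rowForm_mem_of_mem_nilradical N (hφ (Pi.single i 1))
  refine ⟨Matrix.of t, fun v => ?_⟩
  -- The error is linear in `v`, so it suffices to bound it on the standard basis.
  let D : (Fin d → k) →ₗ[k] A N :=
    φ.toLinearMap ∘ₗ rowForm M - rowForm N ∘ₗ (Matrix.of t).vecMulLinear
  have hD (i) : D (Pi.single i 1) ∈ (nilradical (A N) ^ 2).restrictScalars k := by
    simpa [D] using ht i
  change D v ∈ (nilradical (A N) ^ 2).restrictScalars k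
  rw [pi_eq_sum_univ' v, map_sum]
  exact Submodule.sum_mem _ fun i _ => by
    rw [map_smul]
    exact Submodule.smul_mem _ _ (hD i)

/-- Nilpotency indices bound the weight of the linear part of the image of a linear form. -/
theorem hammingNorm_le_of_sub_mem [DecidableEq k] {M N : Matrix (Fin d) (Fin m) k}
    (φ : A M ≃ₐ[k] A N) {v w : Fin d → k}
    (h : φ (rowForm M v) - rowForm N w ∈ nilradical (A N) ^ 2) :
    hammingNorm (Matrix.vecMul w N) ≤ hammingNorm (Matrix.vecMul v M) := by
  have hpow : rowForm M v ^ (hammingNorm (Matrix.vecMul v M) + 1) = 0 := by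
    refine Subtype.ext ?_
    rw [Subalgebra.coe_pow, coe_rowForm]
    exact (linearForm_pow_eq_zero_iff _ _).2 (Nat.lt_succ_self _)
  rw [← Nat.lt_succ_iff, ← linearForm_pow_eq_zero_iff]
  refine linearForm_pow_eq_zero_of_add (map_mem_nilradical_sq (A N).val h) ?_
  have h' := congrArg (fun a => (φ a : B k m)) hpow
  rw [← coe_rowForm]
  simpa using h'

theorem linearlyEquivalent_of_algEquiv {M N : Matrix (Fin d) (Fin m) k} (hM : M.rank = d)
    (φ : A M ≃ₐ[k] A N) : LinearlyEquivalent M N := by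
  classical
  obtain ⟨T, hT⟩ := exists_linear_part φ
  obtain ⟨T', hT'⟩ := exists_linear_part φ.symm
  -- The linear parts of `φ` and of its inverse are mutually inverse.
  have hTT (v) : Matrix.vecMul (Matrix.vecMul v T) T' = v := by
    have h₁ := map_mem_nilradical_sq φ.symm (hT v)
    have h₂ : rowForm M (v - Matrix.vecMul (Matrix.vecMul v T) T') ∈ nilradical (A M) ^ 2 := by
      convert add_mem h₁ (hT' (Matrix.vecMul v T)) using 1
      simp
    have h₃ := vecMul_eq_zero_of_rowForm_mem h₂
    refine (sub_eq_zero.1 (vecMul_injective_of_rank_eq hM ?_)).symm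
    simpa using h₃
  have hT1 : T * T' = 1 := by
    refine Matrix.ext_of_single_vecMul fun i => ?_
    rw [← Matrix.vecMul_vecMul, hTT, Matrix.vecMul_one]
  have hT2 : T' * T = 1 := mul_eq_one_comm.1 hT1
  obtain ⟨P, hP, hMP⟩ := exists_isMonomial_of_hammingNorm_eq M (T * N) fun v => by
    rw [← Matrix.vecMul_vecMul]
    refine le_antisymm ?_ (hammingNorm_le_of_sub_mem φ (hT v))
    have := hammingNorm_le_of_sub_mem φ.symm (hT' (Matrix.vecMul v T))
    rwa [hTT] at this
  refine ⟨T', P, IsUnit.of_mul_eq_one T hT2, hP, ?_⟩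
  rw [Matrix.mul_assoc, hMP, ← Matrix.mul_assoc, hT2, Matrix.one_mul]

end LinearPart

/-! ### Isomorphisms from linear equivalences -/

section Equivalence

variable {k : Type*} [Field k] {d m : ℕ}

theorem A_mul_le (Q : Matrix (Fin d) (Fin d) k) (M : Matrix (Fin d) (Fin m) k) :
    A (Q * M) ≤ A M := by
  refine Algebra.adjoin_le ?_
  rintro _ ⟨i, rfl⟩
  change linearForm (Matrix.vecMul (Q i) M) ∈ A M
  rw [← coe_rowForm]
  exact (rowForm M (Q i)).2

theorem A_mul_of_isUnit {Q : Matrix (Fin d) (Fin d) k} (hQ : IsUnit Q)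
    (M : Matrix (Fin d) (Fin m) k) : A (Q * M) = A M := by
  obtain ⟨u, rfl⟩ := hQ
  refine le_antisymm (A_mul_le _ M) ?_
  have := A_mul_le (↑u⁻¹ : Matrix (Fin d) (Fin d) k) ((u : Matrix (Fin d) (Fin d) k) * M)
  rwa [← Matrix.mul_assoc, Units.inv_mul, Matrix.one_mul] at this

/-- The automorphism `x_{σ j} ↦ a_j x_j` of `B`. -/
noncomputable def monomialEquiv (σ : Equiv.Perm (Fin m)) (a : Fin m → k) (ha : ∀ j, a j ≠ 0) :
    B k m ≃ₐ[k] B k m :=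
  AlgEquiv.ofAlgHom
    (lift (fun i => a (σ.symm i) • x k (σ.symm i)) fun i => by rw [smul_pow, x_sq, smul_zero])
    (lift (fun j => (a j)⁻¹ • x k (σ j)) fun j => by rw [smul_pow, x_sq, smul_zero])
    (algHom_ext fun j => by simp [smul_smul, ha])
    (algHom_ext fun j => by simp [smul_smul, ha])

theorem monomialEquiv_linearForm (σ : Equiv.Perm (Fin m)) (a : Fin m → k) (ha : ∀ j, a j ≠ 0)
    (c : Fin m → k) :
    monomialEquiv σ a ha (linearForm c) = linearForm fun j => c (σ j) * a j := by
  simp only [linearForm, map_sum, map_smul]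
  rw [← Equiv.sum_comp σ]
  refine sum_congr rfl fun j _ => ?_
  simp [monomialEquiv, smul_smul]

theorem map_A_monomialEquiv (M : Matrix (Fin d) (Fin m) k) (σ : Equiv.Perm (Fin m))
    (a : Fin m → k) (ha : ∀ j, a j ≠ 0) :
    (A M).map (monomialEquiv σ a ha : B k m →ₐ[k] B k m) = A (M * monomialMatrix σ a) := by
  rw [A, AlgHom.map_adjoin, ← Set.range_comp, A]
  congr 2
  funext i
  refine (monomialEquiv_linearForm σ a ha (M i)).trans (congrArg linearForm ?_)
  funext j
  exact (mul_monomialMatrix_apply M σ a i j).symm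

theorem LinearlyEquivalent.nonempty_algEquiv {M N : Matrix (Fin d) (Fin m) k}
    (h : LinearlyEquivalent M N) : Nonempty (A M ≃ₐ[k] A N) := by
  obtain ⟨Q, P, hQ, hP, rfl⟩ := h
  obtain ⟨σ, a, ha, rfl⟩ := hP.exists_eq
  rw [Matrix.mul_assoc, A_mul_of_isUnit hQ, ← map_A_monomialEquiv M σ a ha]
  exact ⟨(monomialEquiv σ a ha).subalgebraMap (A M)⟩

end Equivalence

end RepMatroid

theorem theorem1p10 {k : Type*} [Field k] [CharZero k] {d m : ℕ}
    (M N : Matrix (Fin d) (Fin m) k) (hM : M.rank = d) (hN : N.rank = d) :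
    Nonempty (RepMatroid.A M ≃ₐ[k] RepMatroid.A N) ↔
      RepMatroid.RepresentSameMatroid M N ∧ RepMatroid.LinearlyEquivalent M N := by
  refine ⟨?_, fun h => h.2.nonempty_algEquiv⟩
  rintro ⟨φ⟩
  have h := RepMatroid.linearlyEquivalent_of_algEquiv hM φ
  exact ⟨h.representSameMatroid, h⟩
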